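/- Let $\mathbb F$ be an algebraically closed field, and let $n,r\ge 0$ be integers. The slice rank $\operatorname{srk}(T)$ of $T\in U\otimes V\otimes W$ is the smallest $k\ge 0$ such that $T$ is a linear combination of $k$ tensors, each of one of the forms $u\otimes_1 X$, $v\otimes_2 Y$, $w\otimes_3 Z$ with $u\in U$, $X\in V\otimes W$, $v\in V$, $Y\in U\otimes W$, $w\in W$, $Z\in U\otimes V$ (where $\otimes_j$ inserts the vector as the $j$-th tensor factor). Put $\mathcal{SV}_{U\otimes V\otimes W,r}=\{T\in U\otimes V\otimes W:\operatorname{srk}(T)\le r\}$. For every triple $\rho=(r_1,r_2,r_3)$ of non-negative integers with $r_1+r_2+r_3=r$ let $$U'_\rho=\mathbb F^{r_1}\oplus(\mathbb F^n)^{\oplus r_2}\oplus(\mathbb F^n)^{\oplus r_3},\quad V'_\rho=(\mathbb F^n)^{\oplus r_1}\oplus\mathbb F^{r_2}\oplus(\mathbb F^n)^{\oplus r_3},\quad W'_\rho=(\mathbb F^n)^{\oplus r_1}\oplus(\mathbb F^n)^{\oplus r_2}\oplus\mathbb F^{r_3},$$ of dimensions $s_1=r_1+nr_2+nr_3$, $s_2=nr_1+r_2+nr_3$,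 $s_3=nr_1+nr_2+r_3$. Let $e^k_i$ $(i\le r_k)$ be the standard basis of the summand $\mathbb F^{r_k}$ and $e^k_{ij}$ $(i\le r_k,\ j\le n)$ that of each summand $(\mathbb F^n)^{\oplus r_k}$, and let the unit slice rank tensor $S_{n,r_1,r_2,r_3}\in U'_\rho\otimes V'_\rho\otimes W'_\rho$ be $$S_{n,r_1,r_2,r_3}=\sum_{i=1}^{r_1}\sum_{j=1}^n e^1_i\otimes e^1_{ij}\otimes e^1_{ij}+\sum_{i=1}^{r_2}\sum_{j=1}^n e^2_{ij}\otimes e^2_i\otimes e^2_{ij}+\sum_{i=1}^{r_3}\sum_{j=1}^n e^3_{ij}\otimes e^3_{ij}\otimes e^3_i .$$ Let $U,V,W$ be $n$-dimensional $\mathbb F$-vector spaces. For every $\rho$ let $A_\rho,B_\rho,C_\rho$ be finite-dimensional vector spaces containing $U'_\rho,V'_\rho,W'_\rho$, respectively, as well as $U,V,W$, respectively, as subspaces (given by arbitrary linear embeddings). Then $$\mathcal{SV}_{U\otimes V\otimes W,r}=\bigcup_{r_1+r_2+r_3=r}\overline{\bigl(\mathsf{GL}(A_\rho)\times\mathsf{GL}(B_\rho)\times\mathsf{GL}(C_\rho)\bigr)\,S_{n,r_1,r_2,r_3}}\;\cap\;(U\otimes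 V\otimes W),$$ where the closure is the Zariski closure in $A_\rho\otimes B_\rho\otimes C_\rho$. In particular, for every $\rho$ with $s_1,s_2,s_3\ge n$ one may take $A_\rho=U'_\rho$, $B_\rho=V'_\rho$, $C_\rho=W'_\rho$, so that the group is $\mathsf{GL}_{s_1}\times\mathsf{GL}_{s_2}\times\mathsf{GL}_{s_3}$. -/

import Mathlib

open scoped TensorProduct

noncomputable section

namespace SliceRank

/-- The first tensor product `⊗₁ : U × (V ⊗ W) → U ⊗ V ⊗ W`. -/
def otimes₁ {F U V W : Type*} [Field F] [AddCommGroup U] [Module F U] [AddCommGroup V]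
    [Module F V] [AddCommGroup W] [Module F W] (u : U) (x : V ⊗[F] W) : U ⊗[F] (V ⊗[F] W) :=
  u ⊗ₜ[F] x

/-- The second tensor product `⊗₂ : V × (U ⊗ W) → U ⊗ V ⊗ W`, `v ⊗₂ (u ⊗ w) = u ⊗ v ⊗ w`. -/
def otimes₂ {F U V W : Type*} [Field F] [AddCommGroup U] [Module F U] [AddCommGroup V]
    [Module F V] [AddCommGroup W] [Module F W] (v : V) (y : U ⊗[F] W) : U ⊗[F] (V ⊗[F] W) :=
  TensorProduct.leftComm F V U W (v ⊗ₜ[F] y)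

/-- The third tensor product `⊗₃ : W × (U ⊗ V) → U ⊗ V ⊗ W`, `w ⊗₃ (u ⊗ v) = u ⊗ v ⊗ w`. -/
def otimes₃ {F U V W : Type*} [Field F] [AddCommGroup U] [Module F U] [AddCommGroup V]
    [Module F V] [AddCommGroup W] [Module F W] (w : W) (z : U ⊗[F] V) : U ⊗[F] (V ⊗[F] W) :=
  TensorProduct.assoc F U V W (z ⊗ₜ[F] w)

section Rank

variable {F U V W : Type*} [Field F] [AddCommGroup U] [Module F U]
  [AddCommGroup V] [Module F V] [AddCommGroup W] [Module F W]

/-- The building blocks of slice rank: tensors `v_j ⊗_j x` with `v_j` a vector in the `j`-th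
factor and `x` in the tensor product of the two other factors. -/
def IsSlice (T : U ⊗[F] (V ⊗[F] W)) : Prop :=
  (∃ (u : U) (x : V ⊗[F] W), T = otimes₁ u x) ∨
  (∃ (v : V) (y : U ⊗[F] W), T = otimes₂ v y) ∨
  (∃ (w : W) (z : U ⊗[F] V), T = otimes₃ w z)

/-- `T` is a linear combination of `k` slices. -/
def IsCombOfSlices (T : U ⊗[F] (V ⊗[F] W)) (k : ℕ) : Prop :=
  ∃ (c : Fin k → F) (t : Fin k → U ⊗[F] (V ⊗[F] W)),
    (∀ i, IsSlice (t i)) ∧ T = ∑ i, c i • t i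

/-- The slice rank: the least `k` such that `T` is a linear combination of `k` slices
(such a `k` exists by `exists_isCombOfSlices`). -/
def sliceRank (T : U ⊗[F] (V ⊗[F] W)) : ℕ :=
  sInf {k | IsCombOfSlices T k}

theorem exists_isCombOfSlices (T : U ⊗[F] (V ⊗[F] W)) : ∃ k, IsCombOfSlices T k := by
  induction T using TensorProduct.induction_on with
  | zero => exact ⟨0, 0, 0, fun i => i.elim0, by simp⟩
  | tmul u x => exact ⟨1, fun _ => 1, fun _ => u ⊗ₜ x, fun _ => Or.inl ⟨u, x, rfl⟩, by simp⟩
  | add S T hS hT =>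
    obtain ⟨k, c, s, hs, rfl⟩ := hS
    obtain ⟨l, d, t, ht, rfl⟩ := hT
    refine ⟨k + l, Fin.append c d, Fin.append s t, fun i => ?_, ?_⟩
    · refine Fin.addCases (fun j => ?_) (fun j => ?_) i
      · simpa using hs j
      · simpa using ht j
    · simp [Fin.sum_univ_add]

end Rank

/-- The slice rank variety `{T ∈ U ⊗ V ⊗ W : srk T ≤ r}`. -/
def sliceRankVariety (F U V W : Type*) [Field F] [AddCommGroup U] [Module F U]
    [AddCommGroup V] [Module F V] [AddCommGroup W] [Module F W] (r : ℕ) :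
    Set (U ⊗[F] (V ⊗[F] W)) :=
  {T | sliceRank T ≤ r}

/-- The Zariski closure of a subset of a (finite-dimensional) vector space `M`: the common zeros
of all polynomial functions on `M` that vanish on the set. A polynomial function on `M` is a
polynomial expression in linear forms on `M`. -/
def zariskiClosure (F : Type*) {M : Type*} [Field F] [AddCommGroup M] [Module F M]
    (X : Set M) : Set M :=
  {x | ∀ p : MvPolynomial (Module.Dual F M) F,
    (∀ y ∈ X, MvPolynomial.eval (fun φ => φ y) p = 0) → MvPolynomial.eval (fun φ => φ x) p = 0}

/-- The orbit of `T` under the natural action of `GL(A) × GL(B) × GL(C)` on `A ⊗ B ⊗ C`. -/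
def orbit {F A B C : Type*} [Field F] [AddCommGroup A] [Module F A] [AddCommGroup B] [Module F B]
    [AddCommGroup C] [Module F C] (T : A ⊗[F] (B ⊗[F] C)) : Set (A ⊗[F] (B ⊗[F] C)) :=
  {T' | ∃ (a : LinearMap.GeneralLinearGroup F A) (b : LinearMap.GeneralLinearGroup F B)
    (c : LinearMap.GeneralLinearGroup F C),
    T' = TensorProduct.map (a : A →ₗ[F] A)
      (TensorProduct.map (b : B →ₗ[F] B) (c : C →ₗ[F] C)) T}

/-- Triples `(r₁, r₂, r₃)` of natural numbers with `r₁ + r₂ + r₃ = r`. -/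
structure Triple (r : ℕ) where
  r₁ : ℕ
  r₂ : ℕ
  r₃ : ℕ
  sum_eq : r₁ + r₂ + r₃ = r

/-- `U' = F^{r₁} ⊕ (F^n)^{r₂} ⊕ (F^n)^{r₃}`, of dimension `s₁ = r₁ + n r₂ + n r₃`. -/
abbrev U' (F : Type*) (n : ℕ) {r : ℕ} (ρ : Triple r) : Type _ :=
  Fin ρ.r₁ ⊕ (Fin ρ.r₂ × Fin n) ⊕ (Fin ρ.r₃ × Fin n) → F

/-- `V' = (F^n)^{r₁} ⊕ F^{r₂} ⊕ (F^n)^{r₃}`, of dimension `s₂ = n r₁ + r₂ + n r₃`. -/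
abbrev V' (F : Type*) (n : ℕ) {r : ℕ} (ρ : Triple r) : Type _ :=
  (Fin ρ.r₁ × Fin n) ⊕ Fin ρ.r₂ ⊕ (Fin ρ.r₃ × Fin n) → F

/-- `W' = (F^n)^{r₁} ⊕ (F^n)^{r₂} ⊕ F^{r₃}`, of dimension `s₃ = n r₁ + n r₂ + r₃`. -/
abbrev W' (F : Type*) (n : ℕ) {r : ℕ} (ρ : Triple r) : Type _ :=
  (Fin ρ.r₁ × Fin n) ⊕ (Fin ρ.r₂ × Fin n) ⊕ Fin ρ.r₃ → F

/-- A standard basis vector of `ι → F`. -/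
abbrev e (F : Type*) [Field F] {ι : Type*} [DecidableEq ι] (i : ι) : ι → F := Pi.single i 1

/-- The unit slice rank tensor `S_{n, r₁, r₂, r₃} ∈ U' ⊗ V' ⊗ W'`. -/
def unitTensor (F : Type*) [Field F] (n : ℕ) {r : ℕ} (ρ : Triple r) :
    U' F n ρ ⊗[F] (V' F n ρ ⊗[F] W' F n ρ) :=
  (∑ i : Fin ρ.r₁, ∑ j : Fin n,
      e F (.inl i) ⊗ₜ[F] (e F (.inl (i, j)) ⊗ₜ[F] e F (.inl (i, j)))) +
  (∑ i : Fin ρ.r₂, ∑ j : Fin n,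
      e F (.inr (.inl (i, j))) ⊗ₜ[F] (e F (.inr (.inl i)) ⊗ₜ[F] e F (.inr (.inl (i, j))))) +
  (∑ i : Fin ρ.r₃, ∑ j : Fin n,
      e F (.inr (.inr (i, j))) ⊗ₜ[F] (e F (.inr (.inr (i, j))) ⊗ₜ[F] e F (.inr (.inr i))))

end SliceRank

end

/-! Sorting slices by direction splits the slice rank variety into pieces indexed by `ρ`: the sums
of `r₁`, `r₂`, `r₃` slices in the three directions (`sliceRank_le_iff`). The equality is proved for
each `ρ` separately.

Into the closure: expanding the matrix part of each slice in a basis writes a slice sum as the image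
of the unit tensor under three linear maps (`IsSliceSum.exists_map_unitTensor`). These extend to
endomorphisms of `A`, `B`, `C`, which are limits of invertible maps `f + t • 1`
(`map_mem_zariskiClosure_orbit`).

Out of the closure: slice sums of type `ρ` are preserved by linear maps, so the orbit consists of
them and a retraction brings tensors back to `U ⊗ V ⊗ W`. The crux is that they form a closed set
(`exists_eq_sliceSum_of_mem_closure`). A valuation ring plays the role of properness of
Grassmannians: a point `T` of the closure is a specialization of the generic slice sum along a
valuation ring `O`. Matrices `1 - M * N` over `O` kill the generic vectors, hence their joint action
kills the generic slice sum. Reducing to the residue field and then specializing to `F` gives such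
matrices over `F` whose joint action kills `T`, which forces `T` to be a slice sum. -/

namespace SliceRank

/-! ### Slice sums as arrays and the matrices that annihilate them. -/

section Coordinates

open Matrix

variable {a b c : Type*} [Fintype a] [Fintype b] [Fintype c]

/-- The array `∑ u ⊗₁ X + ∑ v ⊗₂ Y + ∑ w ⊗₃ Z` in coordinates. -/
def sliceSum {R a b c : Type*} [CommRing R] {p q s : ℕ}
    (u : Fin p → a → R) (X : Fin p → b → c → R) (v : Fin q → b → R) (Y : Fin q → a → c → R)
    (w : Fin s → c → R) (Z : Fin s → a → b → R) (i : a) (j : b) (k : c) : R :=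
  ∑ t, u t i * X t j k + ∑ t, v t j * Y t i k + ∑ t, w t k * Z t i j

/-- The action of three square matrices on a three-dimensional array. -/
def contract {R : Type*} [CommRing R] (P : Matrix a a R) (Q : Matrix b b R) (S : Matrix c c R)
    (T : a → b → c → R) (i : a) (j : b) (k : c) : R :=
  ∑ i', ∑ j', ∑ k', P i i' * Q j j' * S k k' * T i' j' k'

theorem map_contract {R R' : Type*} [CommRing R] [CommRing R'] (φ : R →+* R')
    (P : Matrix a a R) (Q : Matrix b b R) (S : Matrix c c R)
    (T : a → b → c → R) (i : a) (j : b) (k : c) :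
    φ (contract P Q S T i j k) =
      contract (P.map φ) (Q.map φ) (S.map φ) (fun i j k => φ (T i j k)) i j k := by
  simp [contract, map_sum]

theorem map_one_sub_mul {R R' m n : Type*} [CommRing R] [CommRing R'] [Fintype n] [DecidableEq m]
    (φ : R →+* R') (M : Matrix m n R) (N : Matrix n m R) :
    (1 - M * N).map φ = 1 - M.map φ * N.map φ := by
  rw [Matrix.map_sub _ (map_sub φ), Matrix.map_one _ (map_zero φ) (map_one φ), Matrix.map_mul]

/-- Contraction is multilinear, so each slice acquires a factor `P u`, `Q v` or `S w`, which is
zero. -/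
theorem contract_sliceSum_eq_zero {R : Type*} [CommRing R] {p q s : ℕ}
    (u : Fin p → a → R) (X : Fin p → b → c → R) (v : Fin q → b → R) (Y : Fin q → a → c → R)
    (w : Fin s → c → R) (Z : Fin s → a → b → R)
    (P : Matrix a a R) (Q : Matrix b b R) (S : Matrix c c R)
    (hP : ∀ t, P *ᵥ u t = 0) (hQ : ∀ t, Q *ᵥ v t = 0) (hS : ∀ t, S *ᵥ w t = 0)
    (i : a) (j : b) (k : c) : contract P Q S (sliceSum u X v Y w Z) i j k = 0 := by
  have hP' (t) : ∑ i', P i i' * u t i' = 0 := congrFun (hP t) i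
  have hQ' (t) : ∑ j', Q j j' * v t j' = 0 := congrFun (hQ t) j
  have hS' (t) : ∑ k', S k k' * w t k' = 0 := congrFun (hS t) k
  have h1 : ∑ i', ∑ j', ∑ k', P i i' * Q j j' * S k k' * ∑ t, u t i' * X t j' k' = 0 := by
    calc _ = ∑ j', ∑ k', ∑ t, (∑ i', P i i' * u t i') * (Q j j' * S k k' * X t j' k') := by
          rw [Finset.sum_comm]
          refine Finset.sum_congr rfl fun j' _ => ?_
          rw [Finset.sum_comm]
          refine Finset.sum_congr rfl fun k' _ => ?_
          simp only [Finset.mul_sum, Finset.sum_mul]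
          rw [Finset.sum_comm]
          exact Finset.sum_congr rfl fun t _ => Finset.sum_congr rfl fun i' _ => by ring
      _ = 0 := by simp [hP']
  have h2 : ∑ i', ∑ j', ∑ k', P i i' * Q j j' * S k k' * ∑ t, v t j' * Y t i' k' = 0 := by
    calc _ = ∑ i', ∑ k', ∑ t, (∑ j', Q j j' * v t j') * (P i i' * S k k' * Y t i' k') := by
          refine Finset.sum_congr rfl fun j' _ => ?_
          rw [Finset.sum_comm]
          refine Finset.sum_congr rfl fun k' _ => ?_
          simp only [Finset.mul_sum, Finset.sum_mul]
          rw [Finset.sum_comm]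
          exact Finset.sum_congr rfl fun t _ => Finset.sum_congr rfl fun i' _ => by ring
      _ = 0 := by simp [hQ']
  have h3 : ∑ i', ∑ j', ∑ k', P i i' * Q j j' * S k k' * ∑ t, w t k' * Z t i' j' = 0 := by
    calc _ = ∑ i', ∑ j', ∑ t, (∑ k', S k k' * w t k') * (P i i' * Q j j' * Z t i' j') := by
          refine Finset.sum_congr rfl fun j' _ => Finset.sum_congr rfl fun k' _ => ?_
          simp only [Finset.mul_sum, Finset.sum_mul]
          rw [Finset.sum_comm]
          exact Finset.sum_congr rfl fun t _ => Finset.sum_congr rfl fun i' _ => by ring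
      _ = 0 := by simp [hS']
  simp only [contract, sliceSum, mul_add, Finset.sum_add_distrib, h1, h2, h3, add_zero]

/-- Telescoping: with `Pᵢ = 1 - Mᵢ Nᵢ` acting on the `i`-th index, `T = M₃N₃ T + M₂N₂ P₃ T + M₁N₁
P₂P₃ T + P₁P₂P₃ T`. The last term vanishes, and each other term is a sum of slices along the columns
of `Mᵢ`. -/
theorem exists_eq_sliceSum_of_contract_eq_zero {R : Type*} [CommRing R] {p q s : ℕ}
    [DecidableEq a] [DecidableEq b] [DecidableEq c]
    (M₁ : Matrix a (Fin p) R) (N₁ : Matrix (Fin p) a R)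
    (M₂ : Matrix b (Fin q) R) (N₂ : Matrix (Fin q) b R)
    (M₃ : Matrix c (Fin s) R) (N₃ : Matrix (Fin s) c R) (T : a → b → c → R)
    (h : ∀ i j k, contract (1 - M₁ * N₁) (1 - M₂ * N₂) (1 - M₃ * N₃) T i j k = 0) :
    ∃ u X v Y w Z, T = sliceSum (p := p) (q := q) (s := s) u X v Y w Z := by
  set T' : a → b → c → R := fun i j k => ((1 - M₃ * N₃) *ᵥ T i j) k with hT'
  set T'' : a → b → c → R := fun i j k => ((1 - M₂ * N₂) *ᵥ fun j' => T' i j' k) j with hT''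
  refine ⟨fun t i => M₁ i t, fun t j k => (N₁ *ᵥ fun i' => T'' i' j k) t,
    fun t j => M₂ j t, fun t i k => (N₂ *ᵥ fun j' => T' i j' k) t,
    fun t k => M₃ k t, fun t i j => (N₃ *ᵥ T i j) t, ?_⟩
  funext i j k
  have h₁ : ((1 - M₁ * N₁) *ᵥ fun i' => T'' i' j k) i = 0 := by
    rw [← h i j k]
    simp only [contract, hT'', hT', Matrix.mulVec, dotProduct, Finset.mul_sum, mul_assoc]
  have h₂ : ((1 - M₂ * N₂) *ᵥ fun j' => T' i j' k) j = T'' i j k := rfl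
  have h₃ : ((1 - M₃ * N₃) *ᵥ T i j) k = T' i j k := rfl
  rw [sub_mulVec, one_mulVec, Pi.sub_apply, ← mulVec_mulVec] at h₁ h₂ h₃
  change _ = (M₁ *ᵥ (N₁ *ᵥ fun i' => T'' i' j k)) i + (M₂ *ᵥ (N₂ *ᵥ fun j' => T' i j' k)) j +
    (M₃ *ᵥ (N₃ *ᵥ T i j)) k
  linear_combination h₁ + h₂ + h₃

/-- Over a valuation ring, a vector is annihilated by `1 - M * N` with integral `M` and `N`. -/
theorem exists_integral_annihilator [DecidableEq a] {K : Type*} [Field K] (O : ValuationSubring K)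
    (p : ℕ) (u : Fin p → a → K) :
    ∃ (M : Matrix a (Fin p) O) (N : Matrix (Fin p) a O),
      ∀ t, (1 - M * N).map O.subtype *ᵥ u t = 0 := by
  induction p with
  | zero => exact ⟨0, 0, fun t => t.elim0⟩
  | succ p ih =>
    obtain ⟨M, N, h⟩ := ih (fun t => u t.castSucc)
    set P := (1 - M * N) with hP
    set w : a → K := P.map O.subtype *ᵥ u (Fin.last p) with hw
    have : ∃ (x : a → O) (y : a → O), (1 - (vecMulVec x y).map O.subtype) *ᵥ w = 0 := by
      by_cases hw0 : w = 0
      · exact ⟨0, 0, by simp [hw0]⟩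
      obtain ⟨i₀, hi₀⟩ := Function.ne_iff.mp hw0
      have : Nonempty a := ⟨i₀⟩
      -- Pivot at a coordinate of maximal valuation: `x = w / w i` is then integral, and `1 - x eᵢᵀ`
      -- kills `w`.
      obtain ⟨i, hi⟩ := Finite.exists_max (fun i => O.valuation (w i))
      have hwi : w i ≠ 0 := fun h0 => hi₀ (by simpa [h0] using hi i₀)
      choose x hx using fun j => (O.valuation_le_iff (w j) (w i)).mp (hi j)
      refine ⟨x, Pi.single i 1, ?_⟩
      ext j
      rw [sub_mulVec, one_mulVec]
      rw [Pi.sub_apply, mulVec, dotProduct, Finset.sum_eq_single i]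
      · simp [vecMulVec_apply, hx]
      · intro l _ hl
        simp [vecMulVec_apply, hl]
      · simp
    obtain ⟨x, y, hxy⟩ := this
    -- Appending the column `x` to `M` and the row `y P` to `N` turns `P` into `(1 - x yᵀ) P`, which
    -- still kills the earlier vectors.
    have hmul : 1 - (Matrix.of fun i => Fin.snoc (M i) (x i) : Matrix a (Fin (p + 1)) O) *
        (Matrix.of (Fin.snoc (fun t => N t) (y ᵥ* P)) : Matrix (Fin (p + 1)) a O) =
        (1 - vecMulVec x y) * P := by
      rw [sub_mul, one_mul, vecMulVec_mul, hP, sub_sub]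
      congr 1
      ext i j
      simp [Matrix.mul_apply, Fin.sum_univ_castSucc, vecMulVec_apply]
    refine ⟨Matrix.of fun i => Fin.snoc (M i) (x i),
      Matrix.of (Fin.snoc (fun t => N t) (y ᵥ* P)), fun t => ?_⟩
    rw [hmul]
    have e : ((1 - vecMulVec x y) * P).map O.subtype =
        (1 - (vecMulVec x y).map O.subtype) * P.map O.subtype := by
      rw [Matrix.map_mul, Matrix.map_sub _ (map_sub _), Matrix.map_one _ (map_zero _) (map_one _)]
    rw [e, ← mulVec_mulVec]
    refine Fin.lastCases ?_ (fun t => ?_) t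
    · exact hxy
    · rw [h, mulVec_zero]

end Coordinates

/-! ### Specialization along valuation rings, and closedness of slice sums. -/

/-- Nullstellensatz. -/
theorem exists_algHom_adjoin {F k : Type*} [Field F] [IsAlgClosed F] [Field k] [Algebra F k]
    {s : Set k} (hs : s.Finite) : Nonempty (Algebra.adjoin F s →ₐ[F] F) := by
  have : Algebra.FiniteType F (Algebra.adjoin F s) :=
    (Subalgebra.fg_iff_finiteType _).mp ⟨hs.toFinset, by simp⟩
  obtain ⟨m, hm⟩ := Ideal.exists_maximal (Algebra.adjoin F s)
  let _ := Ideal.Quotient.field m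
  have : Module.Finite F (Algebra.adjoin F s ⧸ m) := finite_of_finite_type_of_isJacobsonRing _ _
  exact ⟨(AlgEquiv.ofBijective (Algebra.ofId F (Algebra.adjoin F s ⧸ m))
    IsAlgClosed.algebraMap_bijective_of_isIntegral).symm.toAlgHom.comp
      (Ideal.Quotient.mkₐ F m)⟩

/-- A specialization of a family in an extension field is induced by a valuation ring. -/
theorem exists_valuationSubring_specialization {F K I : Type*} [Field F] [Field K] [Algebra F K]
    (x : I → K) (t : I → F)
    (h : ∀ p : MvPolynomial I F, MvPolynomial.aeval x p = 0 → MvPolynomial.eval t p = 0) :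
    ∃ (O : ValuationSubring K) (ψ : F →+* IsLocalRing.ResidueField O) (y : I → O),
      (∀ i, (y i : K) = x i) ∧ ∀ i, IsLocalRing.residue O (y i) = ψ (t i) := by
  set φ : MvPolynomial I F →+* K := (MvPolynomial.aeval x : MvPolynomial I F →ₐ[F] K).toRingHom
  set J : Ideal φ.range := (RingHom.ker (MvPolynomial.eval t)).map φ.rangeRestrict with hJ
  have hmem (z) : z ∈ J ↔ ∃ p, MvPolynomial.eval t p = 0 ∧ φ.rangeRestrict p = z := by
    rw [hJ, Ideal.mem_map_iff_of_surjective _ φ.rangeRestrict_surjective]; rfl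
  -- If `p` vanishes at `t` but equals `1` at `x`, then `p - 1` vanishes at `x`, hence at `t`, which
  -- is absurd.
  have hJtop : J ≠ ⊤ := by
    rw [Ideal.ne_top_iff_one, hmem]
    rintro ⟨p, hp, hp1⟩
    have h1 : φ p = 1 := congrArg Subtype.val hp1
    have := h (p - 1) (by rw [map_sub, map_one, sub_eq_zero]; exact h1)
    simp [hp] at this
  -- A valuation ring containing `F[x]` whose maximal ideal contains the polynomials in `x` that
  -- vanish at `t`.
  obtain ⟨O, hO, hn⟩ := Ideal.image_subset_nonunits_valuationSubring J hJtop
  let θ : MvPolynomial I F →+* O := φ.codRestrict O.toSubring fun p => hO ⟨p, rfl⟩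
  have hker (p) (hp : MvPolynomial.eval t p = 0) : IsLocalRing.residue O (θ p) = 0 := by
    rw [IsLocalRing.residue_eq_zero_iff]
    have h1 : φ p ∈ O.nonunits := hn ⟨φ.rangeRestrict p, (hmem _).mpr ⟨p, hp, rfl⟩, rfl⟩
    rw [← SetLike.mem_coe, ← O.image_maximalIdeal] at h1
    obtain ⟨z, hz, hzp⟩ := h1
    have : z = θ p := Subtype.ext hzp
    exact this ▸ hz
  refine ⟨O, ((IsLocalRing.residue O).comp θ).comp MvPolynomial.C, fun i => θ (.X i),
    fun i => ?_, fun i => ?_⟩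
  · change φ (.X i) = x i
    exact MvPolynomial.aeval_X x i
  · have := hker (.X i - .C (t i)) (by simp)
    rwa [map_sub, map_sub, sub_eq_zero] at this

/-- The arrays that are sums of `p`, `q` and `s` slices in the three directions form a Zariski
closed set. -/
theorem exists_eq_sliceSum_of_mem_closure {F a b c : Type*} [Field F] [IsAlgClosed F]
    [Fintype a] [Fintype b] [Fintype c] (p q s : ℕ) (T : a → b → c → F)
    (h : ∀ f : MvPolynomial (a × b × c) F,
      (∀ u X v Y w Z, MvPolynomial.eval
        (fun i => sliceSum (p := p) (q := q) (s := s) u X v Y w Z i.1 i.2.1 i.2.2) f = 0) →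
      MvPolynomial.eval (fun i => T i.1 i.2.1 i.2.2) f = 0) :
    ∃ u X v Y w Z, T = sliceSum (p := p) (q := q) (s := s) u X v Y w Z := by
  classical
  -- One indeterminate for each entry of `u, X, v, Y, w, Z`; `G` is the generic slice sum, viewed
  -- over the function field `K`.
  let τ := (Fin p × a) ⊕ (Fin p × b × c) ⊕ (Fin q × b) ⊕ (Fin q × a × c) ⊕ (Fin s × c) ⊕
    (Fin s × a × b)
  let K := FractionRing (MvPolynomial τ F)
  let x : τ → K := fun i => algebraMap (MvPolynomial τ F) K (.X i)
  let G : a → b → c → MvPolynomial τ F := sliceSum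
    (fun t i => .X (.inl (t, i)))
    (fun t j k => .X (.inr (.inl (t, j, k))))
    (fun t j => .X (.inr (.inr (.inl (t, j)))))
    (fun t i k => .X (.inr (.inr (.inr (.inl (t, i, k))))))
    (fun t k => .X (.inr (.inr (.inr (.inr (.inl (t, k)))))))
    (fun t i j => .X (.inr (.inr (.inr (.inr (.inr (t, i, j)))))))
  have hG (i j k) : algebraMap (MvPolynomial τ F) K (G i j k) = sliceSum
      (fun t i => x (.inl (t, i)))
      (fun t j k => x (.inr (.inl (t, j, k))))
      (fun t j => x (.inr (.inr (.inl (t, j)))))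
      (fun t i k => x (.inr (.inr (.inr (.inl (t, i, k))))))
      (fun t k => x (.inr (.inr (.inr (.inr (.inl (t, k)))))))
      (fun t i j => x (.inr (.inr (.inr (.inr (.inr (t, i, j))))))) i j k := by
    simp only [G, sliceSum, map_add, map_sum, map_mul, x]
  obtain ⟨O, ψ, y, hy, hyT⟩ := exists_valuationSubring_specialization
    (fun i : a × b × c => algebraMap (MvPolynomial τ F) K (G i.1 i.2.1 i.2.2))
    (fun i => T i.1 i.2.1 i.2.2) <| by
      intro f hf
      refine h f fun u X v Y w Z => ?_
      -- A relation satisfied by the generic slice sum holds for every slice sum, by substituting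
      -- values for the indeterminates.
      have h0 : MvPolynomial.aeval (fun i : a × b × c => G i.1 i.2.1 i.2.2) f = 0 := by
        apply IsFractionRing.injective (MvPolynomial τ F) K
        rw [map_zero, ← hf]
        exact (MvPolynomial.aeval_algebraMap_apply K _ f).symm
      let z : τ → F := Sum.elim (fun i => u i.1 i.2) <| Sum.elim (fun i => X i.1 i.2.1 i.2.2) <|
        Sum.elim (fun i => v i.1 i.2) <| Sum.elim (fun i => Y i.1 i.2.1 i.2.2) <|
        Sum.elim (fun i => w i.1 i.2) (fun i => Z i.1 i.2.1 i.2.2)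
      have h1 := congrArg (MvPolynomial.aeval z : MvPolynomial τ F →ₐ[F] F) h0
      rw [map_zero, MvPolynomial.comp_aeval_apply] at h1
      rw [← MvPolynomial.coe_aeval_eq_eval, ← h1]
      change MvPolynomial.aeval _ f = _
      congr 2
      funext i
      simp [G, sliceSum, z]
  obtain ⟨M₁, N₁, h₁⟩ := exists_integral_annihilator O p (fun t i => x (.inl (t, i)))
  obtain ⟨M₂, N₂, h₂⟩ := exists_integral_annihilator O q
    (fun t j => x (.inr (.inr (.inl (t, j)))))
  obtain ⟨M₃, N₃, h₃⟩ := exists_integral_annihilator O s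
    (fun t k => x (.inr (.inr (.inr (.inr (.inl (t, k)))))))
  have hO (i j k) : contract (1 - M₁ * N₁) (1 - M₂ * N₂) (1 - M₃ * N₃)
      (fun i j k => y (i, j, k)) i j k = 0 := by
    apply O.subtype_injective
    rw [map_contract, map_zero]
    have : (fun i j k => O.subtype (y (i, j, k))) = _ :=
      funext fun i => funext fun j => funext fun k => (hy (i, j, k)).trans (hG i j k)
    rw [this]
    exact contract_sliceSum_eq_zero _ _ _ _ _ _ _ _ _ h₁ h₂ h₃ i j k
  let k' := IsLocalRing.ResidueField O
  let _ : Algebra F k' := ψ.toAlgebra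
  -- The residue field may be larger than `F`, but only these finitely many entries matter: the
  -- algebra they generate has an `F`-point `π`, which fixes the entries of `T`.
  let E : Set k' :=
    (Set.range fun i : a × Fin p => IsLocalRing.residue O (M₁ i.1 i.2)) ∪
    (Set.range fun i : Fin p × a => IsLocalRing.residue O (N₁ i.1 i.2)) ∪
    (Set.range fun i : b × Fin q => IsLocalRing.residue O (M₂ i.1 i.2)) ∪
    (Set.range fun i : Fin q × b => IsLocalRing.residue O (N₂ i.1 i.2)) ∪
    (Set.range fun i : c × Fin s => IsLocalRing.residue O (M₃ i.1 i.2)) ∪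
    (Set.range fun i : Fin s × c => IsLocalRing.residue O (N₃ i.1 i.2))
  have hE : E.Finite := by
    simp only [E, Set.finite_union, Set.finite_range, and_self]
  obtain ⟨π⟩ := exists_algHom_adjoin (F := F) hE
  have hsub {z : k'} (hz : z ∈ E) : z ∈ Algebra.adjoin F E := Algebra.subset_adjoin hz
  let M₁' : Matrix a (Fin p) (Algebra.adjoin F E) := fun i t =>
    ⟨IsLocalRing.residue O (M₁ i t), hsub (by simp [E])⟩
  let N₁' : Matrix (Fin p) a (Algebra.adjoin F E) := fun t i =>
    ⟨IsLocalRing.residue O (N₁ t i), hsub (by simp [E])⟩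
  let M₂' : Matrix b (Fin q) (Algebra.adjoin F E) := fun i t =>
    ⟨IsLocalRing.residue O (M₂ i t), hsub (by simp [E])⟩
  let N₂' : Matrix (Fin q) b (Algebra.adjoin F E) := fun t i =>
    ⟨IsLocalRing.residue O (N₂ t i), hsub (by simp [E])⟩
  let M₃' : Matrix c (Fin s) (Algebra.adjoin F E) := fun i t =>
    ⟨IsLocalRing.residue O (M₃ i t), hsub (by simp [E])⟩
  let N₃' : Matrix (Fin s) c (Algebra.adjoin F E) := fun t i =>
    ⟨IsLocalRing.residue O (N₃ t i), hsub (by simp [E])⟩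
  have hS (i j k) : contract (1 - M₁' * N₁') (1 - M₂' * N₂') (1 - M₃' * N₃')
      (fun i j k => algebraMap F (Algebra.adjoin F E) (T i j k)) i j k = 0 := by
    apply Subtype.val_injective
    have h0 := congrArg (IsLocalRing.residue O) (hO i j k)
    rw [map_contract, map_zero, map_one_sub_mul, map_one_sub_mul, map_one_sub_mul] at h0
    have h1 := map_contract (Algebra.adjoin F E).val.toRingHom (1 - M₁' * N₁') (1 - M₂' * N₂')
      (1 - M₃' * N₃') (fun i j k => algebraMap F (Algebra.adjoin F E) (T i j k)) i j k
    rw [map_one_sub_mul, map_one_sub_mul, map_one_sub_mul] at h1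
    refine h1.trans (Eq.trans ?_ h0)
    congr 1
    funext i j k
    exact (hyT (i, j, k)).symm
  refine exists_eq_sliceSum_of_contract_eq_zero (M₁'.map π) (N₁'.map π) (M₂'.map π) (N₂'.map π)
    (M₃'.map π) (N₃'.map π) T fun i j k => ?_
  have h0 := congrArg π.toRingHom (hS i j k)
  rw [map_contract, map_zero, map_one_sub_mul, map_one_sub_mul, map_one_sub_mul] at h0
  refine Eq.trans ?_ h0
  congr 1
  funext i j k
  exact (π.commutes (T i j k)).symm

end SliceRank
namespace SliceRank

/-! ### Slice sums without coordinates, and the comparison with arrays. -/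

section Tensor

variable {F U V W : Type*} [Field F] [AddCommGroup U] [Module F U]
  [AddCommGroup V] [Module F V] [AddCommGroup W] [Module F W]

/-- `T` is a sum of `p`, `q` and `s` slices in the three directions. -/
def IsSliceSum (p q s : ℕ) (T : U ⊗[F] (V ⊗[F] W)) : Prop :=
  ∃ (u : Fin p → U) (X : Fin p → V ⊗[F] W) (v : Fin q → V) (Y : Fin q → U ⊗[F] W)
    (w : Fin s → W) (Z : Fin s → U ⊗[F] V),
    T = ∑ t, otimes₁ (u t) (X t) + ∑ t, otimes₂ (v t) (Y t) + ∑ t, otimes₃ (w t) (Z t)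

theorem isSliceSum_zero (p q s : ℕ) : IsSliceSum p q s (0 : U ⊗[F] (V ⊗[F] W)) :=
  ⟨0, 0, 0, 0, 0, 0, by simp [otimes₁, otimes₂, otimes₃]⟩

theorem IsSliceSum.add {p q s p' q' s' : ℕ} {T T' : U ⊗[F] (V ⊗[F] W)}
    (h : IsSliceSum p q s T) (h' : IsSliceSum p' q' s' T') :
    IsSliceSum (p + p') (q + q') (s + s') (T + T') := by
  obtain ⟨u, X, v, Y, w, Z, rfl⟩ := h
  obtain ⟨u', X', v', Y', w', Z', rfl⟩ := h'
  refine ⟨Fin.append u u', Fin.append X X', Fin.append v v', Fin.append Y Y', Fin.append w w',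
    Fin.append Z Z', ?_⟩
  simp only [Fin.sum_univ_add, Fin.append_left, Fin.append_right]
  abel

theorem IsSliceSum.smul {p q s : ℕ} {T : U ⊗[F] (V ⊗[F] W)} (a : F) (h : IsSliceSum p q s T) :
    IsSliceSum p q s (a • T) := by
  obtain ⟨u, X, v, Y, w, Z, rfl⟩ := h
  refine ⟨u, a • X, v, a • Y, w, a • Z, ?_⟩
  simp [otimes₁, otimes₂, otimes₃, Finset.smul_sum, smul_add, ← TensorProduct.smul_tmul']

theorem IsSlice.exists_isSliceSum {T : U ⊗[F] (V ⊗[F] W)} (h : IsSlice T) :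
    ∃ ρ : Triple 1, IsSliceSum ρ.r₁ ρ.r₂ ρ.r₃ T := by
  rcases h with ⟨u, x, rfl⟩ | ⟨v, y, rfl⟩ | ⟨w, z, rfl⟩
  · exact ⟨⟨1, 0, 0, rfl⟩, fun _ => u, fun _ => x, 0, 0, 0, 0, by simp⟩
  · exact ⟨⟨0, 1, 0, rfl⟩, 0, 0, fun _ => v, fun _ => y, 0, 0, by simp⟩
  · exact ⟨⟨0, 0, 1, rfl⟩, 0, 0, 0, 0, fun _ => w, fun _ => z, by simp⟩

theorem IsCombOfSlices.exists_isSliceSum {k : ℕ} {T : U ⊗[F] (V ⊗[F] W)}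
    (h : IsCombOfSlices T k) : ∃ ρ : Triple k, IsSliceSum ρ.r₁ ρ.r₂ ρ.r₃ T := by
  induction k generalizing T with
  | zero =>
    obtain ⟨c, t, -, rfl⟩ := h
    exact ⟨⟨0, 0, 0, rfl⟩, by simpa using isSliceSum_zero 0 0 0⟩
  | succ k ih =>
    obtain ⟨c, t, ht, rfl⟩ := h
    obtain ⟨ρ, hρ⟩ := ih ⟨fun i => c i.castSucc, fun i => t i.castSucc, fun i => ht _, rfl⟩
    obtain ⟨σ, hσ⟩ := (ht (Fin.last k)).exists_isSliceSum
    refine ⟨⟨ρ.r₁ + σ.r₁, ρ.r₂ + σ.r₂, ρ.r₃ + σ.r₃, ?_⟩, ?_⟩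
    · have := ρ.sum_eq
      have := σ.sum_eq
      omega
    · rw [Fin.sum_univ_castSucc]
      exact hρ.add (hσ.smul _)

theorem IsSliceSum.isCombOfSlices {p q s : ℕ} {T : U ⊗[F] (V ⊗[F] W)}
    (h : IsSliceSum p q s T) : IsCombOfSlices T (p + q + s) := by
  obtain ⟨u, X, v, Y, w, Z, rfl⟩ := h
  refine ⟨1, Fin.append (Fin.append (fun t => otimes₁ (u t) (X t))
    (fun t => otimes₂ (v t) (Y t))) (fun t => otimes₃ (w t) (Z t)), fun i => ?_, ?_⟩
  · refine Fin.addCases (fun i => ?_) (fun i => Or.inr (Or.inr ⟨w i, Z i, by simp⟩)) i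
    refine Fin.addCases (fun i => ?_) (fun i => Or.inr (Or.inl ⟨v i, Y i, by simp⟩)) i
    exact Or.inl ⟨u i, X i, by simp⟩
  · simp [Fin.sum_univ_add]

theorem sliceRank_le_iff {r : ℕ} {T : U ⊗[F] (V ⊗[F] W)} :
    sliceRank T ≤ r ↔ ∃ ρ : Triple r, IsSliceSum ρ.r₁ ρ.r₂ ρ.r₃ T := by
  constructor
  · intro h
    have hk : IsCombOfSlices T (sliceRank T) := Nat.sInf_mem (exists_isCombOfSlices T)
    obtain ⟨ρ, hρ⟩ := hk.exists_isSliceSum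
    -- Zero slices in the first direction make the number of slices exactly `r`.
    refine ⟨⟨ρ.r₁ + (r - sliceRank T), ρ.r₂, ρ.r₃, ?_⟩, ?_⟩
    · have := ρ.sum_eq
      omega
    · simpa using hρ.add (isSliceSum_zero (r - sliceRank T) 0 0)
  · rintro ⟨ρ, hρ⟩
    exact Nat.sInf_le (ρ.sum_eq ▸ hρ.isCombOfSlices)

variable {A B C : Type*} [AddCommGroup A] [Module F A]
  [AddCommGroup B] [Module F B] [AddCommGroup C] [Module F C]

theorem map_otimes₂ (f : U →ₗ[F] A) (g : V →ₗ[F] B) (h : W →ₗ[F] C) (v : V) (y : U ⊗[F] W) :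
    TensorProduct.map f (TensorProduct.map g h) (otimes₂ v y) =
      otimes₂ (g v) (TensorProduct.map f h y) := by
  induction y with
  | zero => simp [otimes₂]
  | tmul u w => simp [otimes₂]
  | add x y hx hy => simpa [otimes₂, TensorProduct.tmul_add] using congrArg₂ (· + ·) hx hy

theorem map_otimes₃ (f : U →ₗ[F] A) (g : V →ₗ[F] B) (h : W →ₗ[F] C) (w : W) (z : U ⊗[F] V) :
    TensorProduct.map f (TensorProduct.map g h) (otimes₃ w z) =
      otimes₃ (h w) (TensorProduct.map f g z) := by
  induction z with
  | zero => simp [otimes₃]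
  | tmul u w => simp [otimes₃]
  | add x y hx hy => simpa [otimes₃, TensorProduct.add_tmul] using congrArg₂ (· + ·) hx hy

theorem IsSliceSum.map {p q s : ℕ} {T : U ⊗[F] (V ⊗[F] W)} (hT : IsSliceSum p q s T)
    (f : U →ₗ[F] A) (g : V →ₗ[F] B) (h : W →ₗ[F] C) :
    IsSliceSum p q s (TensorProduct.map f (TensorProduct.map g h) T) := by
  obtain ⟨u, X, v, Y, w, Z, rfl⟩ := hT
  refine ⟨fun t => f (u t), fun t => TensorProduct.map g h (X t), fun t => g (v t),
    fun t => TensorProduct.map f h (Y t), fun t => h (w t), fun t => TensorProduct.map f g (Z t), ?_⟩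
  simp only [map_add, map_sum, map_otimes₂, map_otimes₃]
  simp only [otimes₁, TensorProduct.map_tmul]

theorem otimes₁_sum_tmul {ι : Type*} [Fintype ι] (u : U) (x : ι → V) (y : ι → W) :
    otimes₁ u (∑ j, x j ⊗ₜ[F] y j) = ∑ j, u ⊗ₜ[F] (x j ⊗ₜ[F] y j) := by
  rw [otimes₁, TensorProduct.tmul_sum]

theorem otimes₂_sum_tmul {ι : Type*} [Fintype ι] (v : V) (x : ι → U) (y : ι → W) :
    otimes₂ v (∑ j, x j ⊗ₜ[F] y j) = ∑ j, x j ⊗ₜ[F] (v ⊗ₜ[F] y j) := by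
  simp [otimes₂, TensorProduct.tmul_sum]

theorem otimes₃_sum_tmul {ι : Type*} [Fintype ι] (w : W) (x : ι → U) (y : ι → V) :
    otimes₃ w (∑ j, x j ⊗ₜ[F] y j) = ∑ j, x j ⊗ₜ[F] (y j ⊗ₜ[F] w) := by
  simp [otimes₃, TensorProduct.sum_tmul]

/-- For fixed `i`, the `n` terms indexed by `j` share a vector and form one slice. -/
theorem isSliceSum_unitTensor (n : ℕ) {r : ℕ} (ρ : Triple r) :
    IsSliceSum ρ.r₁ ρ.r₂ ρ.r₃ (unitTensor F n ρ) := by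
  refine ⟨fun i => e F (.inl i), fun i => ∑ j : Fin n, e F (.inl (i, j)) ⊗ₜ e F (.inl (i, j)),
    fun i => e F (.inr (.inl i)),
    fun i => ∑ j : Fin n, e F (.inr (.inl (i, j))) ⊗ₜ e F (.inr (.inl (i, j))),
    fun i => e F (.inr (.inr i)),
    fun i => ∑ j : Fin n, e F (.inr (.inr (i, j))) ⊗ₜ e F (.inr (.inr (i, j))), ?_⟩
  simp only [unitTensor, otimes₁_sum_tmul, otimes₂_sum_tmul, otimes₃_sum_tmul]

section Basis

variable {a b c : Type*}
  (bU : Module.Basis a F U) (bV : Module.Basis b F V) (bW : Module.Basis c F W)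

theorem repr_otimes₁ (u : U) (x : V ⊗[F] W) (i : a) (j : b) (k : c) :
    (bU.tensorProduct (bV.tensorProduct bW)).repr (otimes₁ u x) (i, j, k) =
      bU.repr u i * (bV.tensorProduct bW).repr x (j, k) := by
  simp [otimes₁, mul_comm]

theorem repr_otimes₂ (v : V) (y : U ⊗[F] W) (i : a) (j : b) (k : c) :
    (bU.tensorProduct (bV.tensorProduct bW)).repr (otimes₂ v y) (i, j, k) =
      bV.repr v j * (bU.tensorProduct bW).repr y (i, k) := by
  induction y with
  | zero => simp [otimes₂]
  | tmul u w => simp [otimes₂]; ring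
  | add x y hx hy =>
    simpa [otimes₂, TensorProduct.tmul_add, mul_add] using congrArg₂ (· + ·) hx hy

theorem repr_otimes₃ (w : W) (z : U ⊗[F] V) (i : a) (j : b) (k : c) :
    (bU.tensorProduct (bV.tensorProduct bW)).repr (otimes₃ w z) (i, j, k) =
      bW.repr w k * (bU.tensorProduct bV).repr z (i, j) := by
  induction z with
  | zero => simp [otimes₃]
  | tmul u v => simp [otimes₃]; ring
  | add x y hx hy =>
    simpa [otimes₃, TensorProduct.add_tmul, mul_add] using congrArg₂ (· + ·) hx hy

theorem isSliceSum_iff_repr [Fintype a] [Fintype b] [Fintype c] {p q s : ℕ} {T : U ⊗[F] (V ⊗[F] W)} :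
    IsSliceSum p q s T ↔ ∃ u X v Y w Z,
      (fun i j k => (bU.tensorProduct (bV.tensorProduct bW)).repr T (i, j, k)) =
        sliceSum (p := p) (q := q) (s := s) u X v Y w Z := by
  constructor
  · rintro ⟨u, X, v, Y, w, Z, rfl⟩
    refine ⟨fun t => bU.repr (u t), fun t j k => (bV.tensorProduct bW).repr (X t) (j, k),
      fun t => bV.repr (v t), fun t i k => (bU.tensorProduct bW).repr (Y t) (i, k),
      fun t => bW.repr (w t), fun t i j => (bU.tensorProduct bV).repr (Z t) (i, j), ?_⟩
    funext i j k
    simp only [map_add, map_sum, Finsupp.add_apply, Finsupp.finsetSum_apply, repr_otimes₁,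
      repr_otimes₂, repr_otimes₃, sliceSum]
  · rintro ⟨u, X, v, Y, w, Z, h⟩
    refine ⟨fun t => bU.equivFun.symm (u t),
      fun t => (bV.tensorProduct bW).equivFun.symm fun i => X t i.1 i.2,
      fun t => bV.equivFun.symm (v t),
      fun t => (bU.tensorProduct bW).equivFun.symm fun i => Y t i.1 i.2,
      fun t => bW.equivFun.symm (w t),
      fun t => (bU.tensorProduct bV).equivFun.symm fun i => Z t i.1 i.2, ?_⟩
    refine (bU.tensorProduct (bV.tensorProduct bW)).ext_elem fun ⟨i, j, k⟩ => ?_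
    refine (congrFun (congrFun (congrFun h i) j) k).trans ?_
    simp only [map_add, map_sum, Finsupp.add_apply, Finsupp.finsetSum_apply, repr_otimes₁,
      repr_otimes₂, repr_otimes₃, sliceSum, ← Module.Basis.equivFun_apply,
      LinearEquiv.apply_symm_apply]

end Basis

/-- Sums of `p`, `q` and `s` slices in the three directions form a Zariski closed set. -/
theorem isSliceSum_of_mem_zariskiClosure [IsAlgClosed F] [FiniteDimensional F A]
    [FiniteDimensional F B] [FiniteDimensional F C] {p q s : ℕ} {S : Set (A ⊗[F] (B ⊗[F] C))}
    (hS : ∀ T ∈ S, IsSliceSum p q s T) {T : A ⊗[F] (B ⊗[F] C)} (hT : T ∈ zariskiClosure F S) :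
    IsSliceSum p q s T := by
  let bA := Module.finBasis F A
  let bB := Module.finBasis F B
  let bC := Module.finBasis F C
  rw [isSliceSum_iff_repr bA bB bC]
  refine exists_eq_sliceSum_of_mem_closure p q s _ fun f hf => ?_
  have h := hT (MvPolynomial.rename
    (fun i => (bA.tensorProduct (bB.tensorProduct bC)).coord i) f) ?_
  · rw [MvPolynomial.eval_rename] at h
    exact h
  · intro y hy
    obtain ⟨u, X, v, Y, w, Z, h⟩ := (isSliceSum_iff_repr bA bB bC).mp (hS y hy)
    rw [MvPolynomial.eval_rename, ← hf u X v Y w Z, ← h]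
    rfl

end Tensor

end SliceRank
namespace SliceRank

/-! ### Degenerations of the unit tensor. -/

section Orbit

variable {F U V W A B C : Type*} [Field F] [AddCommGroup U] [Module F U]
  [AddCommGroup V] [Module F V] [AddCommGroup W] [Module F W] [AddCommGroup A] [Module F A]
  [AddCommGroup B] [Module F B] [AddCommGroup C] [Module F C]

theorem exists_eq_sum_basis_tmul {ι : Type*} [Fintype ι] (b : Module.Basis ι F V)
    (x : V ⊗[F] W) : ∃ y : ι → W, x = ∑ j, b j ⊗ₜ[F] y j := by
  classical
  refine ⟨TensorProduct.equivFinsuppOfBasisLeft b x, ?_⟩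
  conv_lhs => rw [← (TensorProduct.equivFinsuppOfBasisLeft b).symm_apply_apply x]
  rw [TensorProduct.equivFinsuppOfBasisLeft_symm_apply, Finsupp.sum_fintype _ _ (by simp)]

theorem exists_linearMap_apply_e {ι : Type*} [Fintype ι] [DecidableEq ι] (x : ι → U) :
    ∃ f : (ι → F) →ₗ[F] U, ∀ i, f (e F i) = x i :=
  ⟨(Pi.basisFun F ι).constr F x, fun i => by
    rw [e, ← Pi.basisFun_apply, Module.Basis.constr_basis]⟩

/-- Every sum of slices is a specialization of the unit slice rank tensor. -/
theorem IsSliceSum.exists_map_unitTensor {n r : ℕ} (bU : Module.Basis (Fin n) F U)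
    (bV : Module.Basis (Fin n) F V) (ρ : Triple r) {T : U ⊗[F] (V ⊗[F] W)}
    (hT : IsSliceSum ρ.r₁ ρ.r₂ ρ.r₃ T) :
    ∃ (f : U' F n ρ →ₗ[F] U) (g : V' F n ρ →ₗ[F] V) (h : W' F n ρ →ₗ[F] W),
      TensorProduct.map f (TensorProduct.map g h) (unitTensor F n ρ) = T := by
  obtain ⟨u, X, v, Y, w, Z, rfl⟩ := hT
  choose x hx using fun t => exists_eq_sum_basis_tmul bV (X t)
  choose y hy using fun t => exists_eq_sum_basis_tmul bU (Y t)
  choose z hz using fun t => exists_eq_sum_basis_tmul bU (Z t)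
  -- The `eᵏᵢ` go to the slice vectors; the two copies of `eᵏᵢⱼ` go to the `j`-th basis vector and
  -- to its cofactor in the expansion of the matrix part.
  obtain ⟨f, hf⟩ := exists_linearMap_apply_e (F := F) (Sum.elim u (Sum.elim
    (fun i : Fin ρ.r₂ × Fin n => bU i.2) (fun i : Fin ρ.r₃ × Fin n => bU i.2)))
  obtain ⟨g, hg⟩ := exists_linearMap_apply_e (F := F) (Sum.elim
    (fun i : Fin ρ.r₁ × Fin n => bV i.2) (Sum.elim v (fun i : Fin ρ.r₃ × Fin n => z i.1 i.2)))
  obtain ⟨h, hh⟩ := exists_linearMap_apply_e (F := F) (Sum.elim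
    (fun i : Fin ρ.r₁ × Fin n => x i.1 i.2)
    (Sum.elim (fun i : Fin ρ.r₂ × Fin n => y i.1 i.2) w))
  refine ⟨f, g, h, ?_⟩
  simp only [unitTensor, map_add, map_sum, TensorProduct.map_tmul, hf, hg, hh, Sum.elim_inl,
    Sum.elim_inr, hx, hy, hz, otimes₁_sum_tmul, otimes₂_sum_tmul, otimes₃_sum_tmul]

/-- Non-invertibility of `f + t • 1` means that `-t` is an eigenvalue of `f`. -/
theorem finite_not_isUnit_add_smul_one [FiniteDimensional F A] (f : Module.End F A) :
    {t : F | ¬ IsUnit (f + t • (1 : Module.End F A))}.Finite := by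
  refine ((Module.End.finite_hasEigenvalue f).preimage
    (f := fun t : F => -t) neg_injective.injOn).subset fun t ht => ?_
  rw [Set.mem_preimage, Set.mem_ofPred_eq, Module.End.hasEigenvalue_iff_mem_spectrum,
    spectrum.mem_iff]
  intro h
  apply ht
  have e : f + t • (1 : Module.End F A) = -(algebraMap F (Module.End F A) (-t) - f) := by
    rw [map_neg, Algebra.algebraMap_eq_smul_one]
    abel
  exact e ▸ h.neg

/-- The image of a tensor under arbitrary endomorphisms lies in the closure of its orbit. -/
theorem map_mem_zariskiClosure_orbit [Infinite F] [FiniteDimensional F A]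
    [FiniteDimensional F B] [FiniteDimensional F C] (f : Module.End F A) (g : Module.End F B)
    (h : Module.End F C) (T : A ⊗[F] (B ⊗[F] C)) :
    TensorProduct.map f (TensorProduct.map g h) T ∈ zariskiClosure F (orbit T) := by
  intro p hp
  let T₀ := TensorProduct.map f (TensorProduct.map g h) T
  let iA : Module.End F A := 1
  let iB : Module.End F B := 1
  let iC : Module.End F C := 1
  let T₁ := TensorProduct.map iA (TensorProduct.map g h) T +
    TensorProduct.map f (TensorProduct.map iB h) T + TensorProduct.map f (TensorProduct.map g iC) T
  let T₂ := TensorProduct.map iA (TensorProduct.map iB h) T +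
    TensorProduct.map iA (TensorProduct.map g iC) T + TensorProduct.map f (TensorProduct.map iB iC) T
  let T₃ := TensorProduct.map iA (TensorProduct.map iB iC) T
  have hT (t : F) : TensorProduct.map (f + t • iA) (TensorProduct.map (g + t • iB) (h + t • iC)) T =
      T₀ + t • T₁ + t ^ 2 • T₂ + t ^ 3 • T₃ := by
    simp only [TensorProduct.map_add_left, TensorProduct.map_add_right,
      TensorProduct.map_smul_left, TensorProduct.map_smul_right, LinearMap.add_apply,
      LinearMap.smul_apply, T₀, T₁, T₂, T₃]
    module
  -- `P` is `p` restricted to the cubic curve `t ↦ T₀ + t T₁ + t² T₂ + t³ T₃`. It vanishes for all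
  -- but finitely many `t`, where the curve lies in the orbit, so it is zero also at `t = 0`.
  let P : Polynomial F := MvPolynomial.aeval (fun φ : Module.Dual F (A ⊗[F] (B ⊗[F] C)) =>
    Polynomial.C (φ T₀) + Polynomial.C (φ T₁) * .X + Polynomial.C (φ T₂) * .X ^ 2 +
      Polynomial.C (φ T₃) * .X ^ 3) p
  have hP (t : F) : P.eval t = MvPolynomial.eval (fun φ : Module.Dual F (A ⊗[F] (B ⊗[F] C)) =>
      φ (TensorProduct.map (f + t • iA) (TensorProduct.map (g + t • iB) (h + t • iC)) T)) p := by
    change Polynomial.evalRingHom t P = _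
    rw [← Polynomial.coe_aeval_eq_evalRingHom]
    change Polynomial.aeval t (MvPolynomial.aeval _ p) = _
    rw [MvPolynomial.comp_aeval_apply, ← MvPolynomial.coe_aeval_eq_eval]
    change MvPolynomial.aeval _ p = MvPolynomial.aeval _ p
    congr 2
    funext φ
    simp only [hT, map_add, map_smul, smul_eq_mul, map_mul, map_pow, Polynomial.aeval_C,
      Polynomial.aeval_X, Algebra.algebraMap_self, RingHom.id_apply]
    ring
  have hP0 : P = 0 := by
    refine Polynomial.eq_zero_of_infinite_isRoot P <| Set.Infinite.mono ?_
      (((finite_not_isUnit_add_smul_one f).union (finite_not_isUnit_add_smul_one g)).union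
        (finite_not_isUnit_add_smul_one h)).infinite_compl
    intro t ht
    simp only [Set.mem_compl_iff, Set.mem_union, Set.mem_ofPred_eq, not_or, not_not] at ht
    obtain ⟨⟨⟨f', hf'⟩, ⟨g', hg'⟩⟩, ⟨h', hh'⟩⟩ := ht
    rw [Set.mem_ofPred_eq, Polynomial.IsRoot, hP, ← hf', ← hg', ← hh']
    exact hp _ ⟨f', g', h', rfl⟩
  have := hP 0
  simpa [hP0] using this.symm

end Orbit

end SliceRank

/-- For each `ρ = (r₁, r₂, r₃)` the spaces `U'`, `V'`, `W'` sit in `A ρ`, `B ρ`, `C ρ` via `α`, `β`,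
`γ` (with `A ρ = U'`, `B ρ = V'`, `C ρ = W'` and the identity maps allowed, in which case the group
is `GL_{s₁} × GL_{s₂} × GL_{s₃}`), and `U`, `V`, `W` sit in them via `f`, `g`, `h`; intersecting
with `U ⊗ V ⊗ W` is taking the preimage under `f ⊗ g ⊗ h`. -/
theorem mainTheorem5 {F : Type*} [Field F] [IsAlgClosed F] (n r : ℕ)
    {U V W : Type*} [AddCommGroup U] [Module F U] [FiniteDimensional F U]
    [AddCommGroup V] [Module F V] [FiniteDimensional F V]
    [AddCommGroup W] [Module F W] [FiniteDimensional F W]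
    (hU : Module.finrank F U = n) (hV : Module.finrank F V = n) (hW : Module.finrank F W = n)
    {A B C : SliceRank.Triple r → Type*}
    [∀ ρ, AddCommGroup (A ρ)] [∀ ρ, Module F (A ρ)] [∀ ρ, FiniteDimensional F (A ρ)]
    [∀ ρ, AddCommGroup (B ρ)] [∀ ρ, Module F (B ρ)] [∀ ρ, FiniteDimensional F (B ρ)]
    [∀ ρ, AddCommGroup (C ρ)] [∀ ρ, Module F (C ρ)] [∀ ρ, FiniteDimensional F (C ρ)]
    (α : ∀ ρ, SliceRank.U' F n ρ →ₗ[F] A ρ) (hα : ∀ ρ, Function.Injective (α ρ))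
    (β : ∀ ρ, SliceRank.V' F n ρ →ₗ[F] B ρ) (hβ : ∀ ρ, Function.Injective (β ρ))
    (γ : ∀ ρ, SliceRank.W' F n ρ →ₗ[F] C ρ) (hγ : ∀ ρ, Function.Injective (γ ρ))
    (f : ∀ ρ, U →ₗ[F] A ρ) (hf : ∀ ρ, Function.Injective (f ρ))
    (g : ∀ ρ, V →ₗ[F] B ρ) (hg : ∀ ρ, Function.Injective (g ρ))
    (h : ∀ ρ, W →ₗ[F] C ρ) (hh : ∀ ρ, Function.Injective (h ρ)) :
    SliceRank.sliceRankVariety F U V W r =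
      ⋃ ρ : SliceRank.Triple r,
        TensorProduct.map (f ρ) (TensorProduct.map (g ρ) (h ρ)) ⁻¹'
          SliceRank.zariskiClosure F (SliceRank.orbit
            (TensorProduct.map (α ρ) (TensorProduct.map (β ρ) (γ ρ))
              (SliceRank.unitTensor F n ρ))) := by
  ext T
  rw [SliceRank.sliceRankVariety, Set.mem_ofPred_eq, SliceRank.sliceRank_le_iff]
  simp only [Set.mem_iUnion, Set.mem_preimage]
  refine exists_congr fun ρ => ⟨fun hT => ?_, fun hT => ?_⟩
  · obtain ⟨a, b, c, rfl⟩ := hT.exists_map_unitTensor (Module.finBasisOfFinrankEq F U hU)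
      (Module.finBasisOfFinrankEq F V hV) ρ
    -- Left inverses of the embeddings extend `a`, `b`, `c` to endomorphisms of the ambient spaces.
    obtain ⟨α', hα'⟩ := (α ρ).exists_leftInverse_of_injective (LinearMap.ker_eq_bot.mpr (hα ρ))
    obtain ⟨β', hβ'⟩ := (β ρ).exists_leftInverse_of_injective (LinearMap.ker_eq_bot.mpr (hβ ρ))
    obtain ⟨γ', hγ'⟩ := (γ ρ).exists_leftInverse_of_injective (LinearMap.ker_eq_bot.mpr (hγ ρ))
    have := SliceRank.map_mem_zariskiClosure_orbit (f ρ ∘ₗ a ∘ₗ α') (g ρ ∘ₗ b ∘ₗ β')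
      (h ρ ∘ₗ c ∘ₗ γ') (TensorProduct.map (α ρ) (TensorProduct.map (β ρ) (γ ρ))
        (SliceRank.unitTensor F n ρ))
    convert this using 1
    simp only [← LinearMap.comp_apply, ← TensorProduct.map_comp, LinearMap.comp_assoc, hα', hβ',
      hγ', LinearMap.comp_id]
  · have hS := SliceRank.isSliceSum_of_mem_zariskiClosure (p := ρ.r₁) (q := ρ.r₂) (s := ρ.r₃)
      (by
        rintro _ ⟨a, b, c, rfl⟩
        exact ((SliceRank.isSliceSum_unitTensor n ρ).map _ _ _).map _ _ _) hT
    -- Retracting onto `U`, `V`, `W` fixes `T` and keeps the type of the slice sum.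
    obtain ⟨f', hf'⟩ := (f ρ).exists_leftInverse_of_injective (LinearMap.ker_eq_bot.mpr (hf ρ))
    obtain ⟨g', hg'⟩ := (g ρ).exists_leftInverse_of_injective (LinearMap.ker_eq_bot.mpr (hg ρ))
    obtain ⟨h', hh'⟩ := (h ρ).exists_leftInverse_of_injective (LinearMap.ker_eq_bot.mpr (hh ρ))
    have := hS.map f' g' h'
    rwa [← LinearMap.comp_apply, ← TensorProduct.map_comp, ← TensorProduct.map_comp, hf', hg', hh',
      TensorProduct.map_id, TensorProduct.map_id, LinearMap.id_apply] at this
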